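/- Let $\alpha,\beta\in\mathbb C$ with $\Re(\alpha\overline\beta)>0$, and put $M=1-\Re\frac{\beta}{\alpha}$. Write $D_r=\{z\in\mathbb C:|z|<r\}$ and $\mathbb D=D_1$. Let $\mathcal A_{\alpha,\beta}$ be the set of all holomorphic $F:\mathbb D\to\mathbb C$ for which there is a holomorphic $\omega:\mathbb D\to\mathbb D$ with $\omega(0)=0$ and $$F(z)=z\left(\beta+\frac{\alpha\,\omega(z)}{1-\omega(z)}\right)\qquad(z\in\mathbb D),$$ that is, $F(z)/z\prec\beta+\frac{\alpha z}{1-z}$. Each $F\in\mathcal A_{\alpha,\beta}$ has a holomorphic inverse $G=F^{-1}$ near the origin, with $G(0)=0$. Let $\mathcal B_{\alpha,\beta}$ be the set of all these inverses. Define $$R=\begin{cases}|\alpha|\left(\frac12-M\right),&\Re\frac\beta\alpha>\frac34,\\[2pt] |\alpha|\left(1-\sqrt M\right)^2,&\Re\frac\beta\alpha\le\frac34,\end{cases}\qquad R_1=\begin{cases}1,&\Re\frac\beta\alpha>\frac34,\\[2pt] \frac1{\sqrt M}-1,&\Re\frac\beta\alpha\le\frac34,\end{cases}$$ $$R_2=\frac{RR_1}{R_1|\beta|+\sqrt{R_1^2|\beta|^2-R^2}}.$$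 Then every $G\in\mathcal B_{\alpha,\beta}$ extends to a univalent (holomorphic and injective) function on $D_R$, again denoted $G$. This extension satisfies $F(G(w))=w$ for all $w\in D_R$, for every $F\in\mathcal A_{\alpha,\beta}$ whose inverse near the origin is $G$. Moreover $$G(D_R)\subset D_{R_1}\qquad\text{and}\qquad G(D_R)\supset D_{R_2}.$$ -/

import Mathlib

open Metric Set Filter Topology

noncomputable section

namespace InverseClass

/-- The linear fractional function `ψ(z) = β + α z / (1 - z)` on the unit disk. -/
def psi (α β z : ℂ) : ℂ := β + α * z / (1 - z)

/-- Holomorphic self-mappings of the open unit disk that vanish at the origin. -/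
def SchwarzMap (ω : ℂ → ℂ) : Prop :=
  DifferentiableOn ℂ ω (ball 0 1) ∧ MapsTo ω (ball 0 1) (ball 0 1) ∧ ω 0 = 0

/-- The class of functions `F`, holomorphic in the unit disk, with `F(z)/z` subordinate to `ψ`,
that is, `F(z) = z ψ(ω(z))` for some `ω`. Values outside the unit disk are irrelevant. -/
def classA (α β : ℂ) : Set (ℂ → ℂ) :=
  {F | DifferentiableOn ℂ F (ball 0 1) ∧
    ∃ ω : ℂ → ℂ, SchwarzMap ω ∧ ∀ z ∈ ball (0 : ℂ) 1, F z = z * psi α β (ω z)}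

/-- `G` is (a representative of) the inverse function `F⁻¹` near the origin: it is holomorphic
near `0`, vanishes at `0`, and is a two-sided inverse of `F` near `0`. -/
def IsInverseAtZero (F G : ℂ → ℂ) : Prop :=
  AnalyticAt ℂ G 0 ∧ G 0 = 0 ∧ (∀ᶠ w in 𝓝 (0 : ℂ), F (G w) = w) ∧
    ∀ᶠ z in 𝓝 (0 : ℂ), G (F z) = z

/-- The class of inverse functions of members of `classA α β`. -/
def classB (α β : ℂ) : Set (ℂ → ℂ) :=
  {G | ∃ F ∈ classA α β, IsInverseAtZero F G}

/-- `M = 1 - Re (β / α)`. -/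
def paramM (α β : ℂ) : ℝ := 1 - (β / α).re

/-- The radius of univalence `R`. -/
def radiusR (α β : ℂ) : ℝ :=
  if 3 / 4 < (β / α).re then ‖α‖ * (1 / 2 - paramM α β)
  else ‖α‖ * (1 - √(paramM α β)) ^ 2

/-- The radius `R₁` of the disk containing the image. -/
def radiusR₁ (α β : ℂ) : ℝ :=
  if 3 / 4 < (β / α).re then 1 else 1 / √(paramM α β) - 1

/-- The radius `R₂` of the covered disk. -/
def radiusR₂ (α β : ℂ) : ℝ :=
  radiusR α β * radiusR₁ α β /
    (radiusR₁ α β * ‖β‖ + √((radiusR₁ α β) ^ 2 * ‖β‖ ^ 2 - (radiusR α β) ^ 2))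

end InverseClass

end

/-!
Write `F z = z * p z` with `p = ψ ∘ ω`. An inverse of `F` solves `H = w / p H`, and if `m ≤ ‖p‖` on
the disk of radius `r`, then `z ↦ w / p z` maps that disk into itself whenever `‖w‖ < r * m`. The
Picard iterates from `0` are holomorphic in `w`, bounded by `r`, and consecutive ones agree at
`w = 0` to ever higher order. The Schwarz lemma turns this order of contact into geometric
convergence on the whole disk of radius `r * m`, so the inverse extends there with values in the
disk of radius `r`. Since `ψ / α` has real part at least `1 / (1 + r) - M` on the disk of radius
`r`, one may take for `m` the number `‖α‖ * (1 / (1 + r) - M)`; the maximum of `r * m` is `R`,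
attained at `r = R₁`.

Conversely `‖F z‖ ≤ ‖z‖ * (‖β‖ + ‖α‖ * ‖z‖ / (1 - ‖z‖))` shows that `F` maps the disk of radius
`R₂` into that of radius `R`, and `H ∘ F = id` persists there by the identity theorem. Here
`R₂ = R₁ * ρ` where `ρ` is the smaller root of `m * (1 + ρ ^ 2) = 2 * ‖β‖ * ρ` for `r = R₁`, and
`m + ‖α‖ * r / (1 + r) ≤ ‖β‖`.
-/

namespace InverseClass

section PicardIteration

variable {E : Type*} [NormedAddCommGroup E] [NormedSpace ℂ E] {q : E → E} {r R : ℝ} {w : ℂ}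

/-- The Picard iterates, starting at `0`, for the fixed-point equation `z = w • q z`, as functions
of the parameter `w`. -/
def picardIterate (q : E → E) (n : ℕ) (w : ℂ) : E := (fun z ↦ w • q z)^[n] 0

lemma picardIterate_succ (n : ℕ) (w : ℂ) :
    picardIterate q (n + 1) w = w • q (picardIterate q n w) :=
  Function.iterate_succ_apply' _ n 0

lemma picardIterate_zero_right (n : ℕ) : picardIterate q n 0 = 0 := by
  cases n with
  | zero => rfl
  | succ n => rw [picardIterate_succ, zero_smul]

lemma norm_mul_div_lt (hr : 0 < r) (hw : w ∈ ball (0 : ℂ) R) : ‖w‖ * (r / R) < r := by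
  rw [mul_div_left_comm]
  exact mul_lt_of_lt_one_right hr ((div_lt_one (pos_of_mem_ball hw)).2 (mem_ball_zero_iff.1 hw))

lemma picardIterate_mem_closedBall (hr : 0 < r)
    (hq : MapsTo q (ball 0 r) (closedBall 0 (r / R))) (n : ℕ) (hw : w ∈ ball (0 : ℂ) R) :
    picardIterate q n w ∈ closedBall 0 (‖w‖ * (r / R)) := by
  have hR : 0 < R := pos_of_mem_ball hw
  have hmaps : MapsTo (fun z ↦ w • q z) (closedBall 0 (‖w‖ * (r / R)))
      (closedBall 0 (‖w‖ * (r / R))) := fun z hz ↦ by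
    have hqz := hq (closedBall_subset_ball (norm_mul_div_lt hr hw) hz)
    rw [mem_closedBall_zero_iff] at hqz ⊢
    rw [norm_smul]
    gcongr
  exact hmaps.iterate n (mem_closedBall_self (by positivity))

lemma mapsTo_picardIterate (hr : 0 < r) (hq : MapsTo q (ball 0 r) (closedBall 0 (r / R)))
    (n : ℕ) : MapsTo (picardIterate q n) (ball 0 R) (ball 0 r) := fun _ hw ↦
  closedBall_subset_ball (norm_mul_div_lt hr hw) (picardIterate_mem_closedBall hr hq n hw)

lemma differentiableOn_picardIterate (hr : 0 < r) (hd : DifferentiableOn ℂ q (ball 0 r))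
    (hq : MapsTo q (ball 0 r) (closedBall 0 (r / R))) (n : ℕ) :
    DifferentiableOn ℂ (picardIterate q n) (ball 0 R) := by
  induction n with
  | zero => exact differentiableOn_const 0
  | succ n ih =>
    simp only [funext (picardIterate_succ n)]
    exact differentiableOn_id.smul (hd.comp ih (mapsTo_picardIterate hr hq n))

lemma tendsto_picardIterate_nhds_zero (hr : 0 < r) (hR : 0 < R)
    (hd : DifferentiableOn ℂ q (ball 0 r)) (hq : MapsTo q (ball 0 r) (closedBall 0 (r / R)))
    (n : ℕ) : Tendsto (picardIterate q n) (𝓝 0) (𝓝 0) := by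
  have hcont := (differentiableOn_picardIterate hr hd hq n).continuousOn.continuousAt
    (ball_mem_nhds 0 hR)
  rwa [ContinuousAt, picardIterate_zero_right] at hcont

lemma dist_le_mul_dist_of_mapsTo_closedBall {F : Type*} [NormedAddCommGroup F]
    [NormedSpace ℂ F] {f : E → F} {c x z : E} {y : F} {C : ℝ}
    (hd : DifferentiableOn ℂ f (ball x r)) (hf : MapsTo f (ball x r) (closedBall y C))
    (hc : c ∈ ball x (r / 2)) (hz : z ∈ ball c (r / 2)) :
    dist (f z) (f c) ≤ 2 * C / (r / 2) * dist z c := by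
  have hball : ball c (r / 2) ⊆ ball x r := ball_subset (by
    linarith [mem_ball.1 hc])
  refine Complex.dist_le_div_mul_dist_of_mapsTo_ball (hd.mono hball) (fun u hu ↦ ?_) hz
  have hfu := hf (hball hu)
  have hfc := hf (hball (mem_ball_self (pos_of_mem_ball hz)))
  rw [mem_closedBall] at *
  linarith [dist_triangle_right (f u) (f c) y]

/-- The Schwarz lemma on complex lines takes the place of strict differentiability at `x`, so that
`E` may be infinite-dimensional. -/
lemma isBigO_sub_of_mapsTo_closedBall {F : Type*} [NormedAddCommGroup F] [NormedSpace ℂ F]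
    {f : E → F} {x : E} {y : F} {C : ℝ} (hr : 0 < r) (hd : DifferentiableOn ℂ f (ball x r))
    (hf : MapsTo f (ball x r) (closedBall y C)) :
    (fun p : E × E ↦ f p.1 - f p.2) =O[𝓝 (x, x)] fun p ↦ p.1 - p.2 := by
  refine Asymptotics.IsBigO.of_bound (2 * C / (r / 2)) ?_
  have hx : ball x (r / 4) ∈ 𝓝 x := ball_mem_nhds x (by linarith)
  filter_upwards [prod_mem_nhds hx hx] with p hp
  simp only [mem_prod, mem_ball] at hp
  rw [← dist_eq_norm, ← dist_eq_norm]
  refine dist_le_mul_dist_of_mapsTo_closedBall hd hf ?_ ?_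
  · rw [mem_ball]
    linarith
  · rw [mem_ball]
    linarith [dist_triangle_right p.1 p.2 x]

/-- Substitution into `w • q` raises the order of agreement at the origin by one. -/
lemma picardIterate_succ_sub_isLittleO (hr : 0 < r) (hR : 0 < R)
    (hd : DifferentiableOn ℂ q (ball 0 r)) (hq : MapsTo q (ball 0 r) (closedBall 0 (r / R)))
    (n : ℕ) :
    (fun w ↦ picardIterate q (n + 1) w - picardIterate q n w) =o[𝓝 0] fun w ↦ ‖w‖ ^ n := by
  have htendsto := tendsto_picardIterate_nhds_zero hr hR hd hq
  induction n with
  | zero => simpa using (htendsto 1).sub (htendsto 0)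
  | succ n ih =>
    have hlip := (isBigO_sub_of_mapsTo_closedBall hr hd hq).comp_tendsto
      ((htendsto (n + 1)).prodMk_nhds (htendsto n))
    refine ((Asymptotics.isBigO_refl (fun w : ℂ ↦ w) (𝓝 0)).norm_right.smul_isLittleO
      (hlip.trans_isLittleO ih)).congr (fun w ↦ ?_) fun w ↦ ?_
    · simp only [Function.comp_apply, picardIterate_succ, smul_sub]
    · rw [smul_eq_mul, pow_succ']

lemma dist_picardIterate_succ_le (hr : 0 < r)
    (hd : DifferentiableOn ℂ q (ball 0 r)) (hq : MapsTo q (ball 0 r) (closedBall 0 (r / R)))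
    (n : ℕ) (hw : w ∈ ball (0 : ℂ) R) :
    dist (picardIterate q n w) (picardIterate q (n + 1) w) ≤ 2 * r * (‖w‖ / R) ^ (n + 1) := by
  have hschwarz := Complex.dist_le_mul_div_pow_of_mapsTo_ball_of_isLittleO (n := n) (R₂ := 2 * r)
    ((differentiableOn_picardIterate hr hd hq (n + 1)).sub
      (differentiableOn_picardIterate hr hd hq n)) (fun z hz ↦ ?_) ?_ hw
  · simpa [picardIterate_zero_right, dist_eq_norm, norm_sub_rev] using hschwarz
  · have hsucc := mapsTo_picardIterate hr hq (n + 1) hz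
    have hn := mapsTo_picardIterate hr hq n hz
    rw [mem_ball_zero_iff] at hsucc hn
    simp only [Pi.sub_apply, picardIterate_zero_right, sub_zero, mem_closedBall_zero_iff]
    linarith [norm_sub_le (picardIterate q (n + 1) z) (picardIterate q n z)]
  · simpa [picardIterate_zero_right] using
      picardIterate_succ_sub_isLittleO hr (pos_of_mem_ball hw) hd hq n

lemma tendstoUniformlyOn_of_dist_le_geometric {X Y : Type*} [PseudoMetricSpace Y]
    {h : ℕ → X → Y} {H : X → Y} {s : Set X} {C ρ : ℝ} (hρ : 0 ≤ ρ) (hρ₁ : ρ < 1)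
    (hdist : ∀ n, ∀ x ∈ s, dist (h n x) (h (n + 1) x) ≤ C * ρ ^ n)
    (hlim : ∀ x ∈ s, Tendsto (h · x) atTop (𝓝 (H x))) : TendstoUniformlyOn h H atTop s := by
  have hbound : Tendsto (fun n ↦ C * ρ ^ n / (1 - ρ)) atTop (𝓝 0) := by
    simpa using ((tendsto_pow_atTop_nhds_zero_of_lt_one hρ hρ₁).const_mul C).div_const (1 - ρ)
  refine Metric.tendstoUniformlyOn_iff.2 fun ε hε ↦ ?_
  filter_upwards [hbound.eventually_lt_const hε] with n hn x hx
  rw [dist_comm]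
  exact (dist_le_of_le_geometric_of_tendsto ρ C hρ₁ (hdist · x hx) (hlim x hx) n).trans_lt hn

variable [CompleteSpace E]

lemma exists_differentiableOn_tendsto_of_dist_le_geometric {h : ℕ → ℂ → E} {C : ℝ} (hC : 0 ≤ C)
    (hd : ∀ n, DifferentiableOn ℂ (h n) (ball 0 R))
    (hdist : ∀ n, ∀ w ∈ ball (0 : ℂ) R, dist (h n w) (h (n + 1) w) ≤ C * (‖w‖ / R) ^ n) :
    ∃ H : ℂ → E, DifferentiableOn ℂ H (ball 0 R) ∧
      ∀ w ∈ ball (0 : ℂ) R, Tendsto (h · w) atTop (𝓝 (H w)) := by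
  have hlim : ∀ w ∈ ball (0 : ℂ) R, Tendsto (h · w) atTop (𝓝 (limUnder atTop (h · w))) :=
    fun w hw ↦ (cauchySeq_of_le_geometric (‖w‖ / R) C ((div_lt_one (pos_of_mem_ball hw)).2
      (mem_ball_zero_iff.1 hw)) (hdist · w hw)).tendsto_limUnder
  refine ⟨fun w ↦ limUnder atTop (h · w), fun w hw ↦ ?_, hlim⟩
  have hR : 0 < R := pos_of_mem_ball hw
  obtain ⟨s, hws, hsR⟩ := exists_between (mem_ball_zero_iff.1 hw)
  have hs : 0 ≤ s := (norm_nonneg w).trans hws.le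
  have hsub : ball (0 : ℂ) s ⊆ ball 0 R := ball_subset_ball hsR.le
  have hunif := tendstoUniformlyOn_of_dist_le_geometric (div_nonneg hs hR.le)
    ((div_lt_one hR).2 hsR)
    (fun n z hz ↦ (hdist n z (hsub hz)).trans (by
      have hzs : ‖z‖ ≤ s := (mem_ball_zero_iff.1 hz).le
      gcongr))
    fun z hz ↦ hlim z (hsub hz)
  exact ((hunif.tendstoLocallyUniformlyOn.differentiableOn
    (Eventually.of_forall fun n ↦ (hd n).mono hsub) isOpen_ball).differentiableAt
    (isOpen_ball.mem_nhds (mem_ball_zero_iff.2 hws))).differentiableWithinAt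

theorem exists_differentiableOn_isFixedPt_smul (hr : 0 < r) (hR : 0 < R)
    (hd : DifferentiableOn ℂ q (ball 0 r)) (hq : MapsTo q (ball 0 r) (closedBall 0 (r / R))) :
    ∃ H : ℂ → E, DifferentiableOn ℂ H (ball 0 R) ∧ MapsTo H (ball 0 R) (ball 0 r) ∧
      ∀ w ∈ ball (0 : ℂ) R, Function.IsFixedPt (fun z ↦ w • q z) (H w) := by
  obtain ⟨H, hHd, hlim⟩ := exists_differentiableOn_tendsto_of_dist_le_geometric
    (mul_nonneg zero_le_two hr.le) (differentiableOn_picardIterate hr hd hq) fun n w hw ↦ by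
      refine (dist_picardIterate_succ_le hr hd hq n hw).trans ?_
      have hwR : ‖w‖ < R := mem_ball_zero_iff.1 hw
      gcongr 2 * r * ?_
      exact pow_le_pow_of_le_one (by positivity) ((div_le_one hR).2 hwR.le) n.le_succ
  have hmaps : MapsTo H (ball 0 R) (ball 0 r) := fun w hw ↦
    closedBall_subset_ball (norm_mul_div_lt hr hw) <|
      isClosed_closedBall.mem_of_tendsto (hlim w hw) <|
        Eventually.of_forall fun n ↦ picardIterate_mem_closedBall hr hq n hw
  refine ⟨H, hHd, hmaps, fun w hw ↦ isFixedPt_of_tendsto_iterate (hlim w hw) ?_⟩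
  exact (hd.continuousOn.continuousAt (isOpen_ball.mem_nhds (hmaps hw))).const_smul w

end PicardIteration

section HolomorphicInverse

theorem exists_rightInvOn_of_le_norm {p : ℂ → ℂ} {r m : ℝ} (hr : 0 < r) (hm : 0 < m)
    (hd : DifferentiableOn ℂ p (ball 0 r)) (hp : ∀ z ∈ ball (0 : ℂ) r, m ≤ ‖p z‖) :
    ∃ H : ℂ → ℂ, DifferentiableOn ℂ H (ball 0 (r * m)) ∧ H 0 = 0 ∧
      MapsTo H (ball 0 (r * m)) (ball 0 r) ∧
      RightInvOn H (fun z ↦ z * p z) (ball 0 (r * m)) := by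
  have hne : ∀ z ∈ ball (0 : ℂ) r, p z ≠ 0 := fun z hz ↦ norm_pos_iff.1 (hm.trans_le (hp z hz))
  have hinv : MapsTo (fun z ↦ (p z)⁻¹) (ball 0 r) (closedBall 0 (r / (r * m))) := fun z hz ↦ by
    rw [mem_closedBall_zero_iff, norm_inv, div_mul_cancel_left₀ hr.ne']
    exact inv_anti₀ hm (hp z hz)
  obtain ⟨H, hHd, hmaps, hfix⟩ :=
    exists_differentiableOn_isFixedPt_smul hr (mul_pos hr hm) (hd.inv hne) hinv
  refine ⟨H, hHd, ?_, hmaps, fun w hw ↦ ?_⟩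
  · simpa using (hfix 0 (mem_ball_self (mul_pos hr hm))).eq.symm
  · calc H w * p (H w) = w * (p (H w))⁻¹ * p (H w) := by
          congr 1
          exact (hfix w hw).eq.symm
      _ = w := inv_mul_cancel_right₀ (hne _ (hmaps hw)) w

lemma leftInvOn_of_eventually {E : Type*} [NormedAddCommGroup E] [NormedSpace ℂ E] {f : ℂ → E}
    {g : E → ℂ} {U : Set ℂ} {V : Set E} {c : ℂ} (hf : DifferentiableOn ℂ f U)
    (hg : DifferentiableOn ℂ g V) (hfUV : MapsTo f U V) (hUo : IsOpen U)
    (hUc : IsPreconnected U) (hc : c ∈ U) (hgf : ∀ᶠ z in 𝓝 c, g (f z) = z) :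
    LeftInvOn g f U :=
  ((hg.comp hf hfUV).analyticOnNhd hUo).eqOn_of_preconnected_of_eventuallyEq analyticOnNhd_id
    hUc hc hgf

variable {F G H : ℂ → ℂ}

lemma exists_isInverseAtZero_of_deriv_ne_zero (hF : AnalyticAt ℂ F 0) (hF₀ : F 0 = 0)
    (hF' : deriv F 0 ≠ 0) : ∃ G, IsInverseAtZero F G := by
  have hleft := hF.hasStrictDerivAt.eventually_left_inverse hF'
  have hright := hF.hasStrictDerivAt.eventually_right_inverse hF'
  have hG := hF.analyticAt_localInverse hF'
  rw [hF₀] at hright hG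
  exact ⟨_, hG, by simpa [hF₀] using hleft.self_of_nhds, hright, hleft⟩

lemma IsInverseAtZero.congr (hG : IsInverseAtZero F G) (hF : ContinuousAt F 0)
    (hHG : H =ᶠ[𝓝 0] G) : IsInverseAtZero F H := by
  obtain ⟨hGan, hG₀, hright, hleft⟩ := hG
  have hF₀ : F 0 = 0 := by simpa [hG₀] using hright.self_of_nhds
  refine ⟨hGan.congr hHG.symm, hHG.eq_of_nhds.trans hG₀, ?_, ?_⟩
  · filter_upwards [hHG, hright] with w hw hFG
    rwa [hw]
  · filter_upwards [hF.eventually (hF₀.symm ▸ hHG), hleft] with z hz hGF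
    rwa [hz]

lemma IsInverseAtZero.eventuallyEq_of_rightInverse (hG : IsInverseAtZero F G)
    (hH : Tendsto H (𝓝 0) (𝓝 0)) (hFH : ∀ᶠ w in 𝓝 0, F (H w) = w) : H =ᶠ[𝓝 0] G :=
  (eventuallyEq_of_left_inv_of_right_inv hG.2.2.2 hFH hH).symm

lemma IsInverseAtZero.rightInvOn_ball {r : ℝ} {V : Set ℂ} (hG : IsInverseAtZero F G)
    (hF : DifferentiableOn ℂ F V) (hGd : DifferentiableOn ℂ G (ball 0 r))
    (hmaps : MapsTo G (ball 0 r) V) : RightInvOn G F (ball 0 r) := fun _ hw ↦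
  leftInvOn_of_eventually hGd hF hmaps isOpen_ball (convex_ball 0 r).isPreconnected
    (mem_ball_self (pos_of_mem_ball hw)) hG.2.2.1 hw

lemma IsInverseAtZero.leftInvOn_ball {r : ℝ} {V : Set ℂ} (hG : IsInverseAtZero F G)
    (hF : DifferentiableOn ℂ F (ball 0 r)) (hGd : DifferentiableOn ℂ G V)
    (hmaps : MapsTo F (ball 0 r) V) : LeftInvOn G F (ball 0 r) := fun _ hz ↦
  leftInvOn_of_eventually hF hGd hmaps isOpen_ball (convex_ball 0 r).isPreconnected
    (mem_ball_self (pos_of_mem_ball hz)) hG.2.2.2 hz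

end HolomorphicInverse

section Growth

variable {α β z : ℂ} {r : ℝ}

/-- A lower bound for `‖F z / z‖` on the disk of radius `r ≤ 1`, for `F` in `classA α β`: it is
`‖α‖` times the minimum of `re (ψ / α)` on that disk. -/
noncomputable def lowerGrowth (α β : ℂ) (r : ℝ) : ℝ := ‖α‖ * (1 / (1 + r) - paramM α β)

/-- An upper bound for `‖F z / z‖` on the disk of radius `r < 1`, for `F` in `classA α β`. -/
noncomputable def upperGrowth (α β : ℂ) (r : ℝ) : ℝ := ‖β‖ + ‖α‖ * (r / (1 - r))

lemma one_div_one_add_le_re_inv_one_sub (hz : ‖z‖ ≤ r) (hr : r ≤ 1) (hz₁ : z ≠ 1) :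
    1 / (1 + r) ≤ ((1 - z)⁻¹).re := by
  have hr₀ : 0 ≤ r := (norm_nonneg z).trans hz
  have hre : -r ≤ z.re := neg_le_of_abs_le ((Complex.abs_re_le_norm z).trans hz)
  have hnormSq : Complex.normSq (1 - z) ≤ (1 - z).re * (1 + r) := by
    have hsq : Complex.normSq z ≤ r ^ 2 := by
      rw [Complex.normSq_eq_norm_sq]
      gcongr
    rw [Complex.normSq_apply] at hsq ⊢
    simp only [Complex.sub_re, Complex.sub_im, Complex.one_re, Complex.one_im]
    nlinarith [mul_nonneg (neg_le_iff_add_nonneg.1 hre) (sub_nonneg.2 hr)]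
  rw [Complex.inv_re, div_le_div_iff₀ (by linarith)
    (Complex.normSq_pos.2 (sub_ne_zero.2 hz₁.symm)), one_mul]
  exact hnormSq

lemma psi_eq_mul (hα : α ≠ 0) (hz : z ≠ 1) : psi α β z = α * ((1 - z)⁻¹ + (β / α - 1)) := by
  have hz' : 1 - z ≠ 0 := sub_ne_zero.2 hz.symm
  rw [psi]
  field_simp
  ring

lemma lowerGrowth_le_norm_psi (hz : ‖z‖ ≤ r) (hr : r ≤ 1) (hz₁ : z ≠ 1) :
    lowerGrowth α β r ≤ ‖psi α β z‖ := by
  rcases eq_or_ne α 0 with rfl | hα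
  · simp [lowerGrowth]
  rw [lowerGrowth, psi_eq_mul hα hz₁, norm_mul]
  gcongr
  calc 1 / (1 + r) - paramM α β ≤ ((1 - z)⁻¹ + (β / α - 1)).re := by
        simp only [Complex.add_re, Complex.sub_re, Complex.one_re, paramM]
        linarith [one_div_one_add_le_re_inv_one_sub hz hr hz₁]
    _ ≤ ‖(1 - z)⁻¹ + (β / α - 1)‖ := Complex.re_le_norm _

lemma norm_psi_le_upperGrowth (hz : ‖z‖ ≤ r) (hr : r < 1) : ‖psi α β z‖ ≤ upperGrowth α β r := by
  have hr₀ : 0 ≤ r := (norm_nonneg z).trans hz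
  have hone_sub : 1 - r ≤ ‖1 - z‖ := by
    have := norm_sub_norm_le (1 : ℂ) z
    rw [norm_one] at this
    linarith
  have : 0 < 1 - r := sub_pos.2 hr
  calc ‖psi α β z‖ ≤ ‖β‖ + ‖α * z / (1 - z)‖ := norm_add_le _ _
    _ = ‖β‖ + ‖α‖ * (‖z‖ / ‖1 - z‖) := by rw [norm_div, norm_mul, mul_div_assoc]
    _ ≤ ‖β‖ + ‖α‖ * (r / (1 - r)) := by gcongr

end Growth

section ClassA

variable {α β z : ℂ} {F G H ω : ℂ → ℂ} {r : ℝ}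

namespace SchwarzMap

lemma norm_apply_le (hω : SchwarzMap ω) (hz : z ∈ ball (0 : ℂ) 1) : ‖ω z‖ ≤ ‖z‖ :=
  Complex.norm_le_norm_of_mapsTo_ball hω.1 (hω.2.1.mono_right ball_subset_closedBall) hω.2.2
    (mem_ball_zero_iff.1 hz)

lemma apply_ne_one (hω : SchwarzMap ω) (hz : z ∈ ball (0 : ℂ) 1) : ω z ≠ 1 := fun h ↦ by
  simpa [h] using hω.2.1 hz

lemma differentiableOn_psi_comp (hω : SchwarzMap ω) :
    DifferentiableOn ℂ (fun z ↦ psi α β (ω z)) (ball 0 1) :=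
  ((hω.1.const_mul α).div (hω.1.const_sub 1)
    fun _ hz ↦ sub_ne_zero.2 (hω.apply_ne_one hz).symm).const_add β

end SchwarzMap

lemma apply_zero_of_mem_classA (hF : F ∈ classA α β) : F 0 = 0 := by
  obtain ⟨-, ω, -, hFω⟩ := hF
  rw [hFω 0 (mem_ball_self one_pos), zero_mul]

lemma deriv_zero_of_mem_classA (hF : F ∈ classA α β) : deriv F 0 = β := by
  obtain ⟨-, ω, hω, hFω⟩ := hF
  have hnhds : ball (0 : ℂ) 1 ∈ 𝓝 0 := ball_mem_nhds 0 one_pos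
  have hderiv := (hasDerivAt_id' (0 : ℂ)).fun_mul
    ((hω.differentiableOn_psi_comp (α := α) (β := β)).differentiableAt hnhds).hasDerivAt
  rw [(eventuallyEq_of_mem hnhds hFω).deriv_eq, hderiv.deriv]
  simp [psi, hω.2.2]

lemma exists_isInverseAtZero_of_mem_classA (hβ : β ≠ 0) (hF : F ∈ classA α β) :
    ∃ G, IsInverseAtZero F G :=
  exists_isInverseAtZero_of_deriv_ne_zero (hF.1.analyticAt (ball_mem_nhds 0 one_pos))
    (apply_zero_of_mem_classA hF) (by rwa [deriv_zero_of_mem_classA hF])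

lemma IsInverseAtZero.congr_of_mem_classA (hG : IsInverseAtZero F G) (hF : F ∈ classA α β)
    (hHG : H =ᶠ[𝓝 0] G) : IsInverseAtZero F H :=
  hG.congr (hF.1.differentiableAt (ball_mem_nhds 0 one_pos)).continuousAt hHG

theorem exists_univalent_extension_of_mem_classA (hr : 0 < r) (hr₁ : r ≤ 1)
    (hpos : 0 < lowerGrowth α β r) (hF : F ∈ classA α β) (hG : IsInverseAtZero F G) :
    ∃ H : ℂ → ℂ, H =ᶠ[𝓝 0] G ∧ DifferentiableOn ℂ H (ball 0 (r * lowerGrowth α β r)) ∧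
      InjOn H (ball 0 (r * lowerGrowth α β r)) ∧
      MapsTo H (ball 0 (r * lowerGrowth α β r)) (ball 0 r) := by
  obtain ⟨-, ω, hω, hFω⟩ := hF
  have hsub : ball (0 : ℂ) r ⊆ ball 0 1 := ball_subset_ball hr₁
  obtain ⟨H, hHd, hH₀, hmaps, hinv⟩ := exists_rightInvOn_of_le_norm hr hpos
    (hω.differentiableOn_psi_comp.mono hsub) fun z hz ↦
      lowerGrowth_le_norm_psi
        ((hω.norm_apply_le (hsub hz)).trans (mem_ball_zero_iff.1 hz).le) hr₁
        (hω.apply_ne_one (hsub hz))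
  have hFH : RightInvOn H F (ball 0 (r * lowerGrowth α β r)) := fun w hw ↦
    (hFω _ (hsub (hmaps hw))).trans (hinv hw)
  have hnhds : ball (0 : ℂ) (r * lowerGrowth α β r) ∈ 𝓝 0 := ball_mem_nhds 0 (mul_pos hr hpos)
  have hcont : Tendsto H (𝓝 0) (𝓝 0) := by
    simpa only [ContinuousAt, hH₀] using (hHd.differentiableAt hnhds).continuousAt
  exact ⟨H, hG.eventuallyEq_of_rightInverse hcont (eventually_of_mem hnhds hFH), hHd, hFH.injOn,
    hmaps⟩

lemma mapsTo_ball_of_mem_classA (hr : r < 1) (hβ : β ≠ 0) (hF : F ∈ classA α β) :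
    MapsTo F (ball 0 r) (ball 0 (r * upperGrowth α β r)) := fun z hz ↦ by
  obtain ⟨-, ω, hω, hFω⟩ := hF
  have hz₁ : z ∈ ball (0 : ℂ) 1 := ball_subset_ball hr.le hz
  rw [mem_ball_zero_iff] at hz ⊢
  have hr₀ : 0 < r := (norm_nonneg z).trans_lt hz
  have hpos : 0 < upperGrowth α β r :=
    add_pos_of_pos_of_nonneg (norm_pos_iff.2 hβ)
      (mul_nonneg (norm_nonneg α) (div_nonneg hr₀.le (sub_nonneg.2 hr.le)))
  calc ‖F z‖ = ‖z‖ * ‖psi α β (ω z)‖ := by rw [hFω z hz₁, norm_mul]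
    _ ≤ ‖z‖ * upperGrowth α β r := by
        gcongr
        exact norm_psi_le_upperGrowth ((hω.norm_apply_le hz₁).trans hz.le) hr
    _ < r * upperGrowth α β r := by gcongr

end ClassA

section Radii

variable {α β : ℂ}

lemma re_div_pos_iff : 0 < (β / α).re ↔ 0 < (α * (starRingEnd ℂ) β).re := by
  rcases eq_or_ne α 0 with rfl | hα
  · simp
  rw [Complex.div_re, ← add_div, div_pos_iff_of_pos_right (Complex.normSq_pos.2 hα)]
  simp [mul_comm]

lemma half_le_sqrt_paramM (hre : (β / α).re ≤ 3 / 4) : 1 / 2 ≤ √(paramM α β) :=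
  Real.le_sqrt_of_sq_le (by rw [paramM]; linarith)

lemma sqrt_paramM_lt_one (h : 0 < (β / α).re) : √(paramM α β) < 1 := by
  rw [Real.sqrt_lt' one_pos, paramM]
  linarith

lemma radiusR₁_le_one : radiusR₁ α β ≤ 1 := by
  rw [radiusR₁]
  split_ifs with hre
  · rfl
  · have := one_div_le_one_div_of_le one_half_pos (half_le_sqrt_paramM (not_lt.1 hre))
    linarith

lemma radiusR₁_pos (h : 0 < (β / α).re) : 0 < radiusR₁ α β := by
  rw [radiusR₁]
  split_ifs with hre
  · exact one_pos
  · have hM : 0 < √(paramM α β) := one_half_pos.trans_le (half_le_sqrt_paramM (not_lt.1 hre))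
    exact sub_pos.2 (one_lt_one_div hM (sqrt_paramM_lt_one h))

/-- In both cases `R₁` maximizes `r * lowerGrowth α β r` over `0 ≤ r ≤ 1`, the critical point being
given by `(1 + r) ^ 2 * M = 1`. -/
lemma radiusR_eq_mul_lowerGrowth : radiusR α β = radiusR₁ α β * lowerGrowth α β (radiusR₁ α β) := by
  rw [radiusR, radiusR₁, lowerGrowth]
  split_ifs with hre
  · norm_num
  · have hM : 0 < paramM α β := by rw [paramM]; linarith
    have hsqrt : √(paramM α β) ≠ 0 := (Real.sqrt_pos.2 hM).ne'
    rw [add_sub_cancel, one_div_one_div]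
    nth_rewrite 4 [← Real.sq_sqrt hM.le]
    field_simp

lemma radiusR_pos (h : 0 < (β / α).re) : 0 < radiusR α β := by
  have hα : 0 < ‖α‖ := norm_pos_iff.2 fun hα ↦ by simp [hα] at h
  rw [radiusR]
  split_ifs with hre
  · exact mul_pos hα (by rw [paramM]; linarith)
  · exact mul_pos hα (pow_pos (sub_pos.2 (sqrt_paramM_lt_one h)) 2)

lemma lowerGrowth_radiusR₁_pos (h : 0 < (β / α).re) : 0 < lowerGrowth α β (radiusR₁ α β) :=
  pos_of_mul_pos_right (radiusR_eq_mul_lowerGrowth ▸ radiusR_pos h) (radiusR₁_pos h).le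

lemma lowerGrowth_add_le_norm {r : ℝ} (hr : 0 ≤ r) :
    lowerGrowth α β r + ‖α‖ * (r / (1 + r)) ≤ ‖β‖ := by
  have hr₁ : 1 + r ≠ 0 := by positivity
  rcases eq_or_ne α 0 with rfl | hα
  · simp [lowerGrowth]
  calc lowerGrowth α β r + ‖α‖ * (r / (1 + r)) = ‖α‖ * (β / α).re := by
        rw [lowerGrowth, paramM]
        field_simp
        ring
    _ ≤ ‖α‖ * ‖β / α‖ := by
        gcongr
        exact Complex.re_le_norm _
    _ = ‖β‖ := by rw [norm_div, mul_div_cancel₀ _ (norm_ne_zero_iff.2 hα)]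

lemma mul_one_add_sq_div_add_sqrt {a b : ℝ} (ha : 0 < a) (hab : a ≤ b) :
    a * (1 + (a / (b + √(b ^ 2 - a ^ 2))) ^ 2) = 2 * b * (a / (b + √(b ^ 2 - a ^ 2))) := by
  have hsq : √(b ^ 2 - a ^ 2) ^ 2 = b ^ 2 - a ^ 2 :=
    Real.sq_sqrt (sub_nonneg.2 (pow_le_pow_left₀ ha.le hab 2))
  have hpos : 0 < b + √(b ^ 2 - a ^ 2) :=
    add_pos_of_pos_of_nonneg (ha.trans_le hab) (Real.sqrt_nonneg _)
  field_simp
  linear_combination hsq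

section CoveringEstimate

variable {a b A r ρ : ℝ}

lemma lt_one_of_mul_one_add_sq_eq (hA : 0 < A) (hr : 0 < r) (hρ₁ : ρ ≤ 1)
    (hab : a + A * (r / (1 + r)) ≤ b) (hρab : a * (1 + ρ ^ 2) = 2 * b * ρ) : ρ < 1 := by
  refine hρ₁.lt_of_ne fun hρ ↦ ?_
  have : 0 < A * (r / (1 + r)) := by positivity
  rw [hρ] at hρab
  linarith

lemma mul_add_mul_div_one_sub_le (hA : 0 ≤ A) (hr : 0 < r) (hr₁ : r ≤ 1) (hρ : 0 < ρ)
    (hρ₁ : ρ < 1) (hab : a + A * (r / (1 + r)) ≤ b) (hρab : a * (1 + ρ ^ 2) = 2 * b * ρ) :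
    ρ * (b + A * (r * ρ / (1 - r * ρ))) ≤ a := by
  have hrρ : r * ρ < 1 := mul_lt_one_of_nonneg_of_lt_one_right hr₁ hρ.le hρ₁
  have hgap : 2 * ρ * (A * (r / (1 + r))) ≤ a * (1 - ρ) ^ 2 := by
    nlinarith [mul_le_mul_of_nonneg_left hab hρ.le]
  have hfrac : ρ * (1 - ρ) / (1 - r * ρ) ≤ (1 + ρ) / (1 + r) := by
    rw [div_le_div_iff₀ (sub_pos.2 hrρ) (by positivity)]
    nlinarith [mul_le_mul_of_nonneg_right hr₁ hρ.le, sq_nonneg (1 - ρ)]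
  have hterm : 2 * (ρ * (A * (r * ρ / (1 - r * ρ)))) ≤ a * (1 - ρ ^ 2) := by
    refine le_of_mul_le_mul_right ?_ (sub_pos.2 hρ₁)
    calc 2 * (ρ * (A * (r * ρ / (1 - r * ρ)))) * (1 - ρ)
        = 2 * ρ * A * r * (ρ * (1 - ρ) / (1 - r * ρ)) := by ring
      _ ≤ 2 * ρ * A * r * ((1 + ρ) / (1 + r)) := by gcongr
      _ = 2 * ρ * (A * (r / (1 + r))) * (1 + ρ) := by ring
      _ ≤ a * (1 - ρ) ^ 2 * (1 + ρ) := by gcongr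
      _ = a * (1 - ρ ^ 2) * (1 - ρ) := by ring
  linarith

end CoveringEstimate

lemma radiusR₂_eq_mul (h : 0 < (β / α).re) :
    radiusR₂ α β = radiusR₁ α β * (lowerGrowth α β (radiusR₁ α β) /
      (‖β‖ + √(‖β‖ ^ 2 - lowerGrowth α β (radiusR₁ α β) ^ 2))) := by
  have hR₁ : 0 < radiusR₁ α β := radiusR₁_pos h
  rw [radiusR₂, radiusR_eq_mul_lowerGrowth, mul_pow, ← mul_sub,
    Real.sqrt_mul (sq_nonneg _), Real.sqrt_sq hR₁.le, ← mul_add]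
  field_simp

theorem radiusR₂_lt_one_and_mul_upperGrowth_le (h : 0 < (β / α).re) :
    radiusR₂ α β < 1 ∧ radiusR₂ α β * upperGrowth α β (radiusR₂ α β) ≤ radiusR α β := by
  have hα : 0 < ‖α‖ := norm_pos_iff.2 fun hα ↦ by simp [hα] at h
  have hR₁ : 0 < radiusR₁ α β := radiusR₁_pos h
  have hR₁_le : radiusR₁ α β ≤ 1 := radiusR₁_le_one
  have hm : 0 < lowerGrowth α β (radiusR₁ α β) := lowerGrowth_radiusR₁_pos h
  have hmb : lowerGrowth α β (radiusR₁ α β) + ‖α‖ * (radiusR₁ α β / (1 + radiusR₁ α β)) ≤ ‖β‖ :=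
    lowerGrowth_add_le_norm hR₁.le
  have hle : lowerGrowth α β (radiusR₁ α β) ≤ ‖β‖ := le_of_add_le_of_nonneg_left hmb (by positivity)
  have hroot := mul_one_add_sq_div_add_sqrt hm hle
  rw [radiusR₂_eq_mul h, upperGrowth, radiusR_eq_mul_lowerGrowth, mul_assoc]
  set ρ := lowerGrowth α β (radiusR₁ α β) /
    (‖β‖ + √(‖β‖ ^ 2 - lowerGrowth α β (radiusR₁ α β) ^ 2))
  have hρ : 0 < ρ := div_pos hm (add_pos_of_pos_of_nonneg (hm.trans_le hle) (Real.sqrt_nonneg _))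
  have hρ_le : ρ ≤ 1 := div_le_one_of_le₀ (hle.trans (le_add_of_nonneg_right (Real.sqrt_nonneg _)))
    (add_nonneg (norm_nonneg _) (Real.sqrt_nonneg _))
  have hρ_lt : ρ < 1 := lt_one_of_mul_one_add_sq_eq hα hR₁ hρ_le hmb hroot
  refine ⟨mul_lt_one_of_nonneg_of_lt_one_right hR₁_le hρ.le hρ_lt, ?_⟩
  gcongr
  exact mul_add_mul_div_one_sub_le hα.le hR₁ hR₁_le hρ hρ_lt hmb hroot

end Radii

end InverseClass

theorem mainTheorem6 (α β : ℂ) (hαβ : 0 < (α * (starRingEnd ℂ) β).re) :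
    -- every member of the class has an inverse near the origin
    (∀ F ∈ InverseClass.classA α β, ∃ G : ℂ → ℂ, InverseClass.IsInverseAtZero F G) ∧
    -- every inverse `G` extends to a univalent function `H` on the disk of radius `R`
    (∀ G ∈ InverseClass.classB α β, ∃ H : ℂ → ℂ,
      H =ᶠ[𝓝 0] G ∧
      DifferentiableOn ℂ H (ball 0 (InverseClass.radiusR α β)) ∧
      InjOn H (ball 0 (InverseClass.radiusR α β)) ∧
      -- `H` is still the inverse, on the whole disk, of each `F` that `G` inverts near `0`
      (∀ F ∈ InverseClass.classA α β, InverseClass.IsInverseAtZero F G →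
        ∀ w ∈ ball (0 : ℂ) (InverseClass.radiusR α β), F (H w) = w) ∧
      H '' ball 0 (InverseClass.radiusR α β) ⊆ ball 0 (InverseClass.radiusR₁ α β) ∧
      ball 0 (InverseClass.radiusR₂ α β) ⊆ H '' ball 0 (InverseClass.radiusR α β)) := by
  have hre : 0 < (β / α).re := InverseClass.re_div_pos_iff.2 hαβ
  have hβ : β ≠ 0 := fun hβ ↦ by simp [hβ] at hre
  refine ⟨fun F hF ↦ InverseClass.exists_isInverseAtZero_of_mem_classA hβ hF, ?_⟩
  rintro G ⟨F, hF, hG⟩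
  obtain ⟨H, hHG, hHd, hinj, hmaps⟩ := InverseClass.exists_univalent_extension_of_mem_classA
    (InverseClass.radiusR₁_pos hre) InverseClass.radiusR₁_le_one
    (InverseClass.lowerGrowth_radiusR₁_pos hre) hF hG
  rw [← InverseClass.radiusR_eq_mul_lowerGrowth] at hHd hinj hmaps
  refine ⟨H, hHG, hHd, hinj, fun F' hF' hG' ↦ ?_, hmaps.image_subset, ?_⟩
  · exact (hG'.congr_of_mem_classA hF' hHG).rightInvOn_ball hF'.1 hHd
      (hmaps.mono_right (ball_subset_ball InverseClass.radiusR₁_le_one))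
  · obtain ⟨hR₂, hgrowth⟩ := InverseClass.radiusR₂_lt_one_and_mul_upperGrowth_le hre
    have hFmaps := (InverseClass.mapsTo_ball_of_mem_classA hR₂ hβ hF).mono_right
      (ball_subset_ball hgrowth)
    have hHF := (hG.congr_of_mem_classA hF hHG).leftInvOn_ball
      (hF.1.mono (ball_subset_ball hR₂.le)) hHd hFmaps
    exact fun z hz ↦ ⟨F z, hFmaps hz, hHF hz⟩
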